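/- Let $\Omega=\{0,1\}^{\infty}$ be the set of infinite binary sequences (paths). For $\omega\in\Omega$ and $t\ge 0$ let $\omega^t\subseteq\Omega$ be the cylinder of all paths that coincide with $\omega$ in the first $t$ coordinates, and let $\Sigma$ be any $\sigma$-algebra on $\Omega$ (its members are called events) that contains all cylinders. Let $\mathbb P$ be the set of finitely additive probabilities on $(\Omega,\Sigma)$. An opinion is a $P\in\mathbb P$ that is strongly nonatomic: for every event $E$ and every $\alpha\in[0,1]$ there is an event $F\subseteq E$ with $P(F)=\alpha P(E)$. For $P,Q\in\mathbb P$ write $Q\ll P$ if, for every sequence of events $(E_n)$, $P(E_n)\to 0$ implies $Q(E_n)\to 0$; say that $P$ merges with $Q$ if for every $\varepsilon>0$ $$\lim_{t\to\infty}Q\Bigl(\Bigl\{\omega:\ \sup_{E\in\Sigma}\bigl|P(E\mid\omega^t)-Q(E\mid\omega^t)\bigr|>\varepsilon\Bigr\}\Bigr)=0 .$$ Let $\Delta_{\mathrm{BD}}$ be the set of opinions $P$ with the Blackwell--Dubins property: $P$ merges with every $Q\in\mathbb P$ such that $Q\ll P$. A collection $\mathcal I$ of subsets of $\Omega$ is a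 strictly proper ideal if it is closed under taking subsets, closed under finite (pairwise) unions, and contains no cylinder. Theorem 4. For every strictly proper ideal $\mathcal I$ there exists an opinion $P\in\Delta_{\mathrm{BD}}$ such that $P(E)=0$ for every event $E\in\mathcal I$. Moreover, $P$ can be chosen to be an extreme point of the set of all finitely additive probabilities on $\Sigma$ that extend some finitely additive probability $\tilde\pi$ defined on $\mathcal A$, where $\mathcal A$ is the algebra of sets generated by the cylinders, the events in $\mathcal I$ and the events whose complement lies in $\mathcal I$. -/

import Mathlib

open Set Filter Topology

/-- Paths: infinite sequences of outcomes `0` (`false`) or `1` (`true`). -/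
abbrev BinPath : Type := ℕ → Bool

/-- The cylinder of length `t` with base `ω`: all paths which coincide with `ω` in the first
`t` periods. -/
abbrev cyl (ω : BinPath) (t : ℕ) : Set BinPath := PiNat.cylinder (E := fun _ => Bool) ω t

/-- The collection of all cylinders. -/
def cylinders : Set (Set BinPath) := {C | ∃ (ω : BinPath) (t : ℕ), C = cyl ω t}

/-- The collection of events of the `σ`-algebra `Sig`. -/
def events (Sig : MeasurableSpace BinPath) : Set (Set BinPath) := {E | @MeasurableSet BinPath Sig E}

/-- `P` is a finitely additive probability on the algebra of sets `𝒜`. A function on `𝒜` is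
represented by its extension by zero to all sets, so that two probabilities on `𝒜` are equal
exactly when they agree on `𝒜`. -/
structure IsFinAddProb (𝒜 : Set (Set BinPath)) (P : Set BinPath → ℝ) : Prop where
  nonneg : ∀ E ∈ 𝒜, 0 ≤ P E
  univ_eq_one : P univ = 1
  union_eq : ∀ E ∈ 𝒜, ∀ F ∈ 𝒜, Disjoint E F → P (E ∪ F) = P E + P F
  eq_zero_of_notMem : ∀ E, E ∉ 𝒜 → P E = 0

/-- `P` is strongly nonatomic on the events of `Sig`. -/
def StronglyNonatomic (Sig : MeasurableSpace BinPath) (P : Set BinPath → ℝ) : Prop :=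
  ∀ E ∈ events Sig, ∀ α ∈ Icc (0 : ℝ) 1, ∃ F ∈ events Sig, F ⊆ E ∧ P F = α * P E

/-- An opinion: a strongly nonatomic finitely additive probability on the events of `Sig`. -/
def IsOpinion (Sig : MeasurableSpace BinPath) (P : Set BinPath → ℝ) : Prop :=
  IsFinAddProb (events Sig) P ∧ StronglyNonatomic Sig P

/-- Absolute continuity `Q ≪ P` for finitely additive probabilities. -/
def AbsCont (Sig : MeasurableSpace BinPath) (Q P : Set BinPath → ℝ) : Prop :=
  ∀ E : ℕ → Set BinPath, (∀ n, E n ∈ events Sig) →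
    Tendsto (fun n => P (E n)) atTop (𝓝 0) → Tendsto (fun n => Q (E n)) atTop (𝓝 0)

/-- The conditional probability `P (E | C)`; it is only meaningful when `P C > 0`. -/
noncomputable def condProb (P : Set BinPath → ℝ) (E C : Set BinPath) : ℝ := P (E ∩ C) / P C

/-- The distance between the forecasts of `P` and `Q` conditional on the first `t` outcomes
of `ω`: the supremum over all events `E` of `|P (E | ω^t) - Q (E | ω^t)|`. -/
noncomputable def forecastDist (Sig : MeasurableSpace BinPath) (P Q : Set BinPath → ℝ)
    (ω : BinPath) (t : ℕ) : ℝ :=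
  ⨆ E : events Sig, |condProb P E (cyl ω t) - condProb Q E (cyl ω t)|

/-- `P` merges with `Q`: the distance between the forecasts tends to zero in `Q`-probability.
This notion is used only for `Q ≪ P`; then the conditional probabilities are genuine on every
cylinder with `Q (ω^t) > 0`, and the other cylinders of length `t`, of which there are finitely
many, have total `Q`-probability zero. -/
def Merges (Sig : MeasurableSpace BinPath) (P Q : Set BinPath → ℝ) : Prop :=
  ∀ ε : ℝ, 0 < ε → Tendsto (fun t : ℕ => Q {ω | ε < forecastDist Sig P Q ω t}) atTop (𝓝 0)

/-- The Blackwell--Dubins property: `P` merges with every finitely additive probability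
that is absolutely continuous with respect to `P`. -/
def BlackwellDubins (Sig : MeasurableSpace BinPath) (P : Set BinPath → ℝ) : Prop :=
  ∀ Q : Set BinPath → ℝ, IsFinAddProb (events Sig) Q → AbsCont Sig Q P → Merges Sig P Q

/-- `Δ_BD`: the set of all opinions that satisfy the Blackwell--Dubins property. -/
def DeltaBD (Sig : MeasurableSpace BinPath) : Set (Set BinPath → ℝ) :=
  {P | IsOpinion Sig P ∧ BlackwellDubins Sig P}

/-- A strictly proper ideal of subsets of the path space. -/
structure IsStrictlyProperIdeal (I : Set (Set BinPath)) : Prop where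
  mem_of_subset : ∀ S ∈ I, ∀ R, R ⊆ S → R ∈ I
  union_mem : ∀ R ∈ I, ∀ S ∈ I, R ∪ S ∈ I
  cylinder_notMem : ∀ C ∈ cylinders, C ∉ I

/-- The algebra of sets generated by the cylinders, the small events (those in `I`) and the
large events (those whose complement is in `I`). -/
def smallLargeAlgebra (Sig : MeasurableSpace BinPath) (I : Set (Set BinPath)) :
    Set (Set BinPath) :=
  MeasureTheory.generateSetAlgebra (cylinders ∪ {E ∈ events Sig | E ∈ I ∨ Eᶜ ∈ I})

/-- The set of extensions of `p` from `𝒜₁` to `𝒜₂`: all finitely additive probabilities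
on `𝒜₂` which agree with `p` on `𝒜₁`. -/
def extensions (p : Set BinPath → ℝ) (𝒜₁ 𝒜₂ : Set (Set BinPath)) : Set (Set BinPath → ℝ) :=
  {Q | IsFinAddProb 𝒜₂ Q ∧ ∀ A ∈ 𝒜₁, Q A = p A}

/-!
Start from a probability that is uniform on the cylinders and vanishes on the ideal; it exists by
compactness, because uniform mixtures of ultrafilters avoiding the ideal have these properties up
to any given length. Let `P` be an extreme point of the set of probabilities which agree with it on
the cylinders and on the events of the ideal.

For an event `E`, the densities of `P (· ∩ E)` with respect to `P` on the partitions into cylinders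
form a bounded martingale. By Pythagoras it is Cauchy in `L²`, so the part of `P (· ∩ E)` missed by
these densities converges, uniformly over events, to an additive `D` with `|D| ≤ P` that vanishes
on the cylinders and on the ideal. As `P + D` and `P - D` are both admissible, extremality gives
`D = 0`, and rounding the densities to `0` or `1` approximates `E` in `P` by finite unions of
cylinders.

If `Q ≪ P`, the same approximation holds in `P + Q`, so the part of `Q` missed by its densities with
respect to `P + Q` tends to `0` uniformly over events. Collecting, on each cylinder where the
forecasts differ by more than `ε`, an event that witnesses the difference, one obtains a single
event on which this part is at least `ε / 2` times the sum of `min P Q` over these cylinders. Hence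
that sum tends to `0`, and with it the `Q`-mass of these cylinders.

Finally, cylinders of small mass allow any value below `P E` to be enclosed between the values of
an increasing and a decreasing sequence of events inside `E`; the union of the increasing sequence,
an event as `Sig` is a `σ`-algebra, takes that value.
-/

open MeasureTheory

section Charge

variable {X ι κ : Type*} {𝒜 : Set (Set X)} {μ ν : Set X → ℝ} {c : X → ι} {E F : Set X}

/-- Finite additivity of a real-valued, possibly signed, set function on a collection of sets. -/
def AdditiveOn (𝒜 : Set (Set X)) (μ : Set X → ℝ) : Prop :=
  ∀ E ∈ 𝒜, ∀ F ∈ 𝒜, Disjoint E F → μ (E ∪ F) = μ E + μ F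

/-- A charge: a nonnegative finitely additive set function, here with finite values. Its values
outside `𝒜` are arbitrary. -/
structure IsCharge (𝒜 : Set (Set X)) (μ : Set X → ℝ) : Prop where
  nonneg : ∀ E ∈ 𝒜, 0 ≤ μ E
  additiveOn : AdditiveOn 𝒜 μ

theorem AdditiveOn.inter_add_sdiff (hμ : AdditiveOn 𝒜 μ) (h𝒜 : IsSetAlgebra 𝒜) (hE : E ∈ 𝒜)
    (hF : F ∈ 𝒜) : μ (E ∩ F) + μ (E \ F) = μ E := by
  rw [← hμ _ (h𝒜.inter_mem hE hF) _ (h𝒜.sdiff_mem hE hF) disjoint_sdiff_inter.symm,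
    inter_union_sdiff]

theorem AdditiveOn.empty (hμ : AdditiveOn 𝒜 μ) (h𝒜 : IsSetAlgebra 𝒜) : μ ∅ = 0 := by
  have h := hμ ∅ h𝒜.empty_mem ∅ h𝒜.empty_mem (disjoint_empty _)
  rwa [empty_union, left_eq_add] at h

theorem IsCharge.mono (hμ : IsCharge 𝒜 μ) (h𝒜 : IsSetAlgebra 𝒜) (hE : E ∈ 𝒜) (hF : F ∈ 𝒜)
    (hEF : E ⊆ F) : μ E ≤ μ F := by
  have h := hμ.additiveOn.inter_add_sdiff h𝒜 hF hE
  rw [inter_eq_self_of_subset_right hEF] at h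
  linarith [hμ.nonneg _ (h𝒜.sdiff_mem hF hE)]

theorem IsCharge.add (hμ : IsCharge 𝒜 μ) (hν : IsCharge 𝒜 ν) : IsCharge 𝒜 (μ + ν) where
  nonneg E hE := add_nonneg (hμ.nonneg E hE) (hν.nonneg E hE)
  additiveOn E hE F hF hEF := by
    simp only [Pi.add_apply, hμ.additiveOn E hE F hF hEF, hν.additiveOn E hE F hF hEF]
    ring

theorem AdditiveOn.restrict (hμ : AdditiveOn 𝒜 μ) (h𝒜 : IsSetAlgebra 𝒜) (hE : E ∈ 𝒜) :
    AdditiveOn 𝒜 fun F => μ (F ∩ E) := by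
  intro F hF G hG hFG
  beta_reduce
  rw [union_inter_distrib_right]
  exact hμ _ (h𝒜.inter_mem hF hE) _ (h𝒜.inter_mem hG hE)
    (hFG.mono inter_subset_left inter_subset_left)

theorem IsCharge.restrict (hμ : IsCharge 𝒜 μ) (h𝒜 : IsSetAlgebra 𝒜) (hE : E ∈ 𝒜) :
    IsCharge 𝒜 fun F => μ (F ∩ E) where
  nonneg _ hF := hμ.nonneg _ (h𝒜.inter_mem hF hE)
  additiveOn := hμ.additiveOn.restrict h𝒜 hE

theorem preimage_mem_of_fiber_mem [Finite ι] (h𝒜 : IsSetAlgebra 𝒜)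
    (hc : ∀ i, c ⁻¹' {i} ∈ 𝒜) (T : Set ι) : c ⁻¹' T ∈ 𝒜 := by
  have hT := T.toFinite
  rw [← biUnion_preimage_singleton, ← hT.coe_toFinset]
  exact h𝒜.biUnion_mem _ fun i _ => hc i

theorem AdditiveOn.sum_inter_fiber [Finite ι] (hμ : AdditiveOn 𝒜 μ) (h𝒜 : IsSetAlgebra 𝒜)
    (hc : ∀ i, c ⁻¹' {i} ∈ 𝒜) (hE : E ∈ 𝒜) (T : Finset ι) :
    ∑ i ∈ T, μ (E ∩ c ⁻¹' {i}) = μ (E ∩ c ⁻¹' T) := by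
  classical
  induction T using Finset.induction with
  | empty => simp [hμ.empty h𝒜]
  | insert i T hi ih =>
    have hdisj : Disjoint (E ∩ c ⁻¹' {i}) (E ∩ c ⁻¹' T) :=
      ((disjoint_singleton_left.2 hi).preimage c).mono inter_subset_right inter_subset_right
    rw [Finset.sum_insert hi, ih, ← hμ _ (h𝒜.inter_mem hE (hc i)) _
      (h𝒜.inter_mem hE (preimage_mem_of_fiber_mem h𝒜 hc T)) hdisj,
      ← inter_union_distrib_left, ← preimage_union, Finset.coe_insert, insert_eq]

theorem AdditiveOn.sum_inter_fiber_univ [Fintype ι] (hμ : AdditiveOn 𝒜 μ)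
    (h𝒜 : IsSetAlgebra 𝒜) (hc : ∀ i, c ⁻¹' {i} ∈ 𝒜) (hE : E ∈ 𝒜) :
    ∑ i, μ (E ∩ c ⁻¹' {i}) = μ E := by
  simp [hμ.sum_inter_fiber h𝒜 hc hE]

theorem AdditiveOn.sum_fiber [Finite ι] (hμ : AdditiveOn 𝒜 μ) (h𝒜 : IsSetAlgebra 𝒜)
    (hc : ∀ i, c ⁻¹' {i} ∈ 𝒜) (T : Finset ι) : ∑ i ∈ T, μ (c ⁻¹' {i}) = μ (c ⁻¹' T) := by
  simpa only [univ_inter] using hμ.sum_inter_fiber h𝒜 hc h𝒜.univ_mem T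

theorem AdditiveOn.sum_mul_inter_fiber_comp [Fintype ι] [Fintype κ] (hμ : AdditiveOn 𝒜 μ)
    (h𝒜 : IsSetAlgebra 𝒜) (hc : ∀ i, c ⁻¹' {i} ∈ 𝒜) (hE : E ∈ 𝒜) (g : ι → κ) (a : κ → ℝ) :
    ∑ j, a j * μ (E ∩ (g ∘ c) ⁻¹' {j}) = ∑ i, a (g i) * μ (E ∩ c ⁻¹' {i}) := by
  classical
  rw [← Finset.sum_fiberwise Finset.univ g]
  refine Finset.sum_congr rfl fun j _ => ?_
  calc a j * μ (E ∩ (g ∘ c) ⁻¹' {j})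
      = a j * ∑ i with g i = j, μ (E ∩ c ⁻¹' {i}) := by
        rw [hμ.sum_inter_fiber h𝒜 hc hE, Finset.coe_filter_univ]; rfl
    _ = ∑ i with g i = j, a (g i) * μ (E ∩ c ⁻¹' {i}) := by
        rw [Finset.mul_sum]
        exact Finset.sum_congr rfl fun i hi => by rw [(Finset.mem_filter.1 hi).2]

theorem AdditiveOn.sum_mul_fiber_comp [Fintype ι] [Fintype κ] (hμ : AdditiveOn 𝒜 μ)
    (h𝒜 : IsSetAlgebra 𝒜) (hc : ∀ i, c ⁻¹' {i} ∈ 𝒜) (g : ι → κ) (a : κ → ℝ) :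
    ∑ j, a j * μ ((g ∘ c) ⁻¹' {j}) = ∑ i, a (g i) * μ (c ⁻¹' {i}) := by
  simpa only [univ_inter] using hμ.sum_mul_inter_fiber_comp h𝒜 hc h𝒜.univ_mem g a

end Charge

section Density

variable {X ι κ : Type*} {𝒜 : Set (Set X)} {μ ν : Set X → ℝ} {c : X → ι} {F : Set X}

/-- The density of `ν` with respect to `μ` on the cell `c ⁻¹' {i}` of the partition of `X` into the
fibres of `c`. It is `0` when the cell is `μ`-null. -/
noncomputable def cellDensity (μ ν : Set X → ℝ) (c : X → ι) (i : ι) : ℝ :=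
  ν (c ⁻¹' {i}) / μ (c ⁻¹' {i})

/-- The part of `ν` which is not accounted for by its density with respect to `μ` on the finite
partition of `X` into the fibres of `c`. -/
noncomputable def densityDefect [Fintype ι] (μ ν : Set X → ℝ) (c : X → ι) (F : Set X) : ℝ :=
  ν F - ∑ i, cellDensity μ ν c i * μ (F ∩ c ⁻¹' {i})

/-- The squared `L²(μ)` norm of the density of `ν` on the partition of `X` into the fibres of
`c`. -/
noncomputable def densityEnergy [Fintype ι] (μ ν : Set X → ℝ) (c : X → ι) : ℝ :=
  ∑ i, cellDensity μ ν c i * ν (c ⁻¹' {i})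

theorem cellDensity_nonneg (hμ : IsCharge 𝒜 μ) (hν : IsCharge 𝒜 ν) {i : ι}
    (hi : c ⁻¹' {i} ∈ 𝒜) : 0 ≤ cellDensity μ ν c i :=
  div_nonneg (hν.nonneg _ hi) (hμ.nonneg _ hi)

theorem cellDensity_le_one (hμ : IsCharge 𝒜 μ) (hle : ∀ E ∈ 𝒜, ν E ≤ μ E) {i : ι}
    (hi : c ⁻¹' {i} ∈ 𝒜) : cellDensity μ ν c i ≤ 1 :=
  div_le_one_of_le₀ (hle _ hi) (hμ.nonneg _ hi)

theorem cellDensity_mul (hν : IsCharge 𝒜 ν) (hle : ∀ E ∈ 𝒜, ν E ≤ μ E) {i : ι}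
    (hi : c ⁻¹' {i} ∈ 𝒜) : cellDensity μ ν c i * μ (c ⁻¹' {i}) = ν (c ⁻¹' {i}) := by
  refine div_mul_cancel_of_imp fun h => le_antisymm ?_ (hν.nonneg _ hi)
  exact (hle _ hi).trans h.le

variable [Fintype ι] [Fintype κ]

theorem AdditiveOn.densityDefect (hμ : AdditiveOn 𝒜 μ) (hν : AdditiveOn 𝒜 ν)
    (h𝒜 : IsSetAlgebra 𝒜) (hc : ∀ i, c ⁻¹' {i} ∈ 𝒜) : AdditiveOn 𝒜 (densityDefect μ ν c) := by
  intro E hE F hF hEF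
  have hsplit (i : ι) : μ ((E ∪ F) ∩ c ⁻¹' {i}) = μ (E ∩ c ⁻¹' {i}) + μ (F ∩ c ⁻¹' {i}) :=
    hμ.restrict h𝒜 (hc i) E hE F hF hEF
  simp only [_root_.densityDefect, hν E hE F hF hEF, hsplit, mul_add, Finset.sum_add_distrib]
  ring

theorem abs_densityDefect_le (hμ : IsCharge 𝒜 μ) (hν : IsCharge 𝒜 ν) (h𝒜 : IsSetAlgebra 𝒜)
    (hle : ∀ E ∈ 𝒜, ν E ≤ μ E) (hc : ∀ i, c ⁻¹' {i} ∈ 𝒜) (hF : F ∈ 𝒜) :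
    |densityDefect μ ν c F| ≤ μ F := by
  have hnonneg (i : ι) : 0 ≤ μ (F ∩ c ⁻¹' {i}) := hμ.nonneg _ (h𝒜.inter_mem hF (hc i))
  have hsum_nonneg : 0 ≤ ∑ i, cellDensity μ ν c i * μ (F ∩ c ⁻¹' {i}) :=
    Finset.sum_nonneg fun i _ => mul_nonneg (cellDensity_nonneg hμ hν (hc i)) (hnonneg i)
  have hsum_le : ∑ i, cellDensity μ ν c i * μ (F ∩ c ⁻¹' {i}) ≤ μ F := by
    rw [← hμ.additiveOn.sum_inter_fiber_univ h𝒜 hc hF]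
    exact Finset.sum_le_sum fun i _ =>
      mul_le_of_le_one_left (hnonneg i) (cellDensity_le_one hμ hle (hc i))
  rw [densityDefect, abs_le]
  constructor <;> linarith [hν.nonneg F hF, hle F hF]

theorem densityDefect_preimage (hμ : IsCharge 𝒜 μ) (hν : IsCharge 𝒜 ν) (h𝒜 : IsSetAlgebra 𝒜)
    (hle : ∀ E ∈ 𝒜, ν E ≤ μ E) (hc : ∀ i, c ⁻¹' {i} ∈ 𝒜) (T : Set ι) :
    densityDefect μ ν c (c ⁻¹' T) = 0 := by
  have hcell (i : ι) : cellDensity μ ν c i * μ (c ⁻¹' T ∩ c ⁻¹' {i}) =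
      ν (c ⁻¹' T ∩ c ⁻¹' {i}) := by
    rw [← preimage_inter]
    by_cases hi : i ∈ T
    · rw [inter_eq_self_of_subset_right (singleton_subset_iff.2 hi), cellDensity_mul hν hle (hc i)]
    · rw [inter_singleton_eq_empty.2 hi, preimage_empty, hμ.additiveOn.empty h𝒜,
        hν.additiveOn.empty h𝒜, mul_zero]
  simp only [densityDefect, hcell]
  rw [hν.additiveOn.sum_inter_fiber_univ h𝒜 hc (preimage_mem_of_fiber_mem h𝒜 hc T), sub_self]

theorem densityDefect_eq_sum (hν : AdditiveOn 𝒜 ν) (h𝒜 : IsSetAlgebra 𝒜)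
    (hc : ∀ i, c ⁻¹' {i} ∈ 𝒜) (hF : F ∈ 𝒜) :
    densityDefect μ ν c F =
      ∑ i, (ν (F ∩ c ⁻¹' {i}) - cellDensity μ ν c i * μ (F ∩ c ⁻¹' {i})) := by
  rw [densityDefect, Finset.sum_sub_distrib, hν.sum_inter_fiber_univ h𝒜 hc hF]

theorem densityDefect_biUnion_inter_fiber (hμ : AdditiveOn 𝒜 μ) (hν : AdditiveOn 𝒜 ν)
    (h𝒜 : IsSetAlgebra 𝒜) (hc : ∀ i, c ⁻¹' {i} ∈ 𝒜) (T : Finset ι) {A : ι → Set X}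
    (hA : ∀ i ∈ T, A i ∩ c ⁻¹' {i} ∈ 𝒜) :
    densityDefect μ ν c (⋃ i ∈ T, A i ∩ c ⁻¹' {i}) =
      ∑ i ∈ T, (ν (A i ∩ c ⁻¹' {i}) - cellDensity μ ν c i * μ (A i ∩ c ⁻¹' {i})) := by
  have hmem : (⋃ i ∈ T, A i ∩ c ⁻¹' {i}) ∈ 𝒜 := h𝒜.biUnion_mem T hA
  have hinter (i : ι) (hi : i ∈ T) :
      (⋃ j ∈ T, A j ∩ c ⁻¹' {j}) ∩ c ⁻¹' {i} = A i ∩ c ⁻¹' {i} := by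
    ext x; aesop
  have hinter' (i : ι) (hi : i ∉ T) :
      (⋃ j ∈ T, A j ∩ c ⁻¹' {j}) ∩ c ⁻¹' {i} = ∅ := by
    ext x; aesop
  rw [densityDefect_eq_sum hν h𝒜 hc hmem, ← Finset.sum_subset T.subset_univ]
  · exact Finset.sum_congr rfl fun i hi => by rw [hinter i hi]
  · intro i _ hi
    rw [hinter' i hi, hμ.empty h𝒜, hν.empty h𝒜, mul_zero, sub_zero]

theorem densityEnergy_le (hμ : IsCharge 𝒜 μ) (hν : IsCharge 𝒜 ν) (h𝒜 : IsSetAlgebra 𝒜)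
    (hle : ∀ E ∈ 𝒜, ν E ≤ μ E) (hc : ∀ i, c ⁻¹' {i} ∈ 𝒜) : densityEnergy μ ν c ≤ μ univ := by
  calc densityEnergy μ ν c ≤ ∑ i, ν (c ⁻¹' {i}) :=
        Finset.sum_le_sum fun i _ =>
          mul_le_of_le_one_left (hν.nonneg _ (hc i)) (cellDensity_le_one hμ hle (hc i))
    _ = ν univ := by simp [hν.additiveOn.sum_fiber h𝒜 hc]
    _ ≤ μ univ := hle _ h𝒜.univ_mem

-- Pythagoras: the density on the coarser partition is the `L²(μ)` projection of the finer one.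
theorem sum_sq_cellDensity_sub (hμ : IsCharge 𝒜 μ) (hν : IsCharge 𝒜 ν) (h𝒜 : IsSetAlgebra 𝒜)
    (hle : ∀ E ∈ 𝒜, ν E ≤ μ E) (hc : ∀ i, c ⁻¹' {i} ∈ 𝒜) (g : ι → κ) :
    ∑ i, (cellDensity μ ν c i - cellDensity μ ν (g ∘ c) (g i)) ^ 2 * μ (c ⁻¹' {i}) =
      densityEnergy μ ν c - densityEnergy μ ν (g ∘ c) := by
  set d := cellDensity μ ν c
  set d' := cellDensity μ ν (g ∘ c)
  have hgc (j : κ) : (g ∘ c) ⁻¹' {j} ∈ 𝒜 := preimage_mem_of_fiber_mem h𝒜 hc (g ⁻¹' {j})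
  have hcross : ∑ i, d' (g i) * ν (c ⁻¹' {i}) = densityEnergy μ ν (g ∘ c) :=
    (hν.additiveOn.sum_mul_fiber_comp h𝒜 hc g d').symm
  have hcoarse : ∑ i, d' (g i) ^ 2 * μ (c ⁻¹' {i}) = densityEnergy μ ν (g ∘ c) := by
    rw [← hμ.additiveOn.sum_mul_fiber_comp h𝒜 hc g (fun j => d' j ^ 2)]
    exact Finset.sum_congr rfl fun j _ => by
      rw [sq, mul_assoc, cellDensity_mul hν hle (hgc j)]
  calc ∑ i, (d i - d' (g i)) ^ 2 * μ (c ⁻¹' {i})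
      = ∑ i, (d i * ν (c ⁻¹' {i}) - 2 * (d' (g i) * ν (c ⁻¹' {i})) +
          d' (g i) ^ 2 * μ (c ⁻¹' {i})) := by
        refine Finset.sum_congr rfl fun i _ => ?_
        linear_combination (d i - 2 * d' (g i)) * cellDensity_mul hν hle (hc i)
    _ = densityEnergy μ ν c - 2 * densityEnergy μ ν (g ∘ c) + densityEnergy μ ν (g ∘ c) := by
        rw [Finset.sum_add_distrib, Finset.sum_sub_distrib, ← Finset.mul_sum, hcross, hcoarse]
        rfl
    _ = densityEnergy μ ν c - densityEnergy μ ν (g ∘ c) := by ring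

theorem densityEnergy_comp_le (hμ : IsCharge 𝒜 μ) (hν : IsCharge 𝒜 ν) (h𝒜 : IsSetAlgebra 𝒜)
    (hle : ∀ E ∈ 𝒜, ν E ≤ μ E) (hc : ∀ i, c ⁻¹' {i} ∈ 𝒜) (g : ι → κ) :
    densityEnergy μ ν (g ∘ c) ≤ densityEnergy μ ν c := by
  rw [← sub_nonneg, ← sum_sq_cellDensity_sub hμ hν h𝒜 hle hc g]
  exact Finset.sum_nonneg fun i _ => mul_nonneg (sq_nonneg _) (hμ.nonneg _ (hc i))

theorem sq_densityDefect_sub_comp_le (hμ : IsCharge 𝒜 μ) (hν : IsCharge 𝒜 ν)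
    (h𝒜 : IsSetAlgebra 𝒜) (hle : ∀ E ∈ 𝒜, ν E ≤ μ E) (hc : ∀ i, c ⁻¹' {i} ∈ 𝒜) (g : ι → κ)
    (hF : F ∈ 𝒜) :
    (densityDefect μ ν c F - densityDefect μ ν (g ∘ c) F) ^ 2 ≤
      μ univ * (densityEnergy μ ν c - densityEnergy μ ν (g ∘ c)) := by
  set δ : ι → ℝ := fun i => cellDensity μ ν c i - cellDensity μ ν (g ∘ c) (g i)
  have hdiff : densityDefect μ ν c F - densityDefect μ ν (g ∘ c) F =
      -∑ i, δ i * μ (F ∩ c ⁻¹' {i}) := by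
    simp only [δ, densityDefect, sub_mul, Finset.sum_sub_distrib,
      hμ.additiveOn.sum_mul_inter_fiber_comp h𝒜 hc hF g]
    ring
  have hmass : ∑ i, μ (c ⁻¹' {i}) = μ univ := by simp [hμ.additiveOn.sum_fiber h𝒜 hc]
  rw [hdiff, neg_sq, ← sum_sq_cellDensity_sub hμ hν h𝒜 hle hc g, ← hmass]
  refine Finset.sum_sq_le_sum_mul_sum_of_sq_le_mul _ (fun i _ => hμ.nonneg _ (hc i))
    (fun i _ => mul_nonneg (sq_nonneg _) (hμ.nonneg _ (hc i))) fun i _ => ?_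
  have hle_cell : μ (F ∩ c ⁻¹' {i}) ≤ μ (c ⁻¹' {i}) :=
    hμ.mono h𝒜 (h𝒜.inter_mem hF (hc i)) (hc i) inter_subset_right
  calc (δ i * μ (F ∩ c ⁻¹' {i})) ^ 2 = δ i ^ 2 * μ (F ∩ c ⁻¹' {i}) ^ 2 := mul_pow _ _ _
    _ ≤ δ i ^ 2 * μ (c ⁻¹' {i}) ^ 2 := by
        gcongr
        exact hμ.nonneg _ (h𝒜.inter_mem hF (hc i))
    _ = μ (c ⁻¹' {i}) * (δ i ^ 2 * μ (c ⁻¹' {i})) := by ring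

end Density

section Refining

variable {X : Type*} {ι : ℕ → Type*} {𝒜 : Set (Set X)} {μ ν D : Set X → ℝ} {c : ∀ t, X → ι t}
  {E : Set X}

/-- A sequence of partitions of `X`, each refining the earlier ones, whose cells belong to `𝒜`.
The `t`-th partition is encoded as the family of fibres of the labelling `c t`. -/
structure IsRefining (𝒜 : Set (Set X)) (c : ∀ t, X → ι t) : Prop where
  fiber_mem : ∀ t i, c t ⁻¹' {i} ∈ 𝒜
  exists_eq_comp : ∀ s t, s ≤ t → ∃ g : ι t → ι s, c s = g ∘ c t

/-- Density, for the pseudometric `μ (E ∆ F)`, of the sets which are unions of cells of one of the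
partitions `c t`. -/
def FiberDense (𝒜 : Set (Set X)) (μ : Set X → ℝ) (c : ∀ t, X → ι t) : Prop :=
  ∀ E ∈ 𝒜, ∀ ε > 0, ∃ t, ∃ T : Set (ι t), μ (symmDiff E (c t ⁻¹' T)) < ε

/-- Absolute continuity of `ν` with respect to `μ` on `𝒜`, in its `ε`-`δ` form. -/
def UniformAbsCont (𝒜 : Set (Set X)) (ν μ : Set X → ℝ) : Prop :=
  ∀ ε > 0, ∃ δ > 0, ∀ F ∈ 𝒜, μ F < δ → ν F < ε

theorem AdditiveOn.apply_symmDiff {F : Set X} (hμ : AdditiveOn 𝒜 μ) (h𝒜 : IsSetAlgebra 𝒜)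
    (hE : E ∈ 𝒜) (hF : F ∈ 𝒜) : μ (symmDiff E F) = μ (E \ F) + μ (F \ E) :=
  hμ _ (h𝒜.sdiff_mem hE hF) _ (h𝒜.sdiff_mem hF hE)
    (disjoint_sdiff_left.mono_right sdiff_subset)

theorem symmDiff_mem_of_isSetAlgebra {F : Set X} (h𝒜 : IsSetAlgebra 𝒜) (hE : E ∈ 𝒜) (hF : F ∈ 𝒜) :
    symmDiff E F ∈ 𝒜 :=
  h𝒜.union_mem (h𝒜.sdiff_mem hE hF) (h𝒜.sdiff_mem hF hE)

theorem FiberDense.eq_zero [∀ t, Finite (ι t)] (hdense : FiberDense 𝒜 μ c)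
    (hμ : AdditiveOn 𝒜 μ) (hD : AdditiveOn 𝒜 D) (h𝒜 : IsSetAlgebra 𝒜)
    (hc : ∀ t i, c t ⁻¹' {i} ∈ 𝒜) (hDμ : ∀ F ∈ 𝒜, |D F| ≤ μ F)
    (hD₀ : ∀ t T, D (c t ⁻¹' T) = 0) (hE : E ∈ 𝒜) : D E = 0 := by
  refine abs_nonpos_iff.1 (le_of_forall_pos_le_add fun ε hε => ?_)
  obtain ⟨t, T, hT⟩ := hdense E hE ε hε
  have hF : c t ⁻¹' T ∈ 𝒜 := preimage_mem_of_fiber_mem h𝒜 (hc t) T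
  set F := c t ⁻¹' T
  have hDE : D E = D (E \ F) - D (F \ E) := by
    have hsplitE := hD.inter_add_sdiff h𝒜 hE hF
    have hsplitF := hD.inter_add_sdiff h𝒜 hF hE
    rw [inter_comm, hD₀ t T] at hsplitF
    linarith
  calc |D E| ≤ |D (E \ F)| + |D (F \ E)| := hDE ▸ abs_sub _ _
    _ ≤ μ (E \ F) + μ (F \ E) :=
        add_le_add (hDμ _ (h𝒜.sdiff_mem hE hF)) (hDμ _ (h𝒜.sdiff_mem hF hE))
    _ = μ (symmDiff E F) := (hμ.apply_symmDiff h𝒜 hE hF).symm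
    _ ≤ 0 + ε := by linarith

theorem FiberDense.add [∀ t, Finite (ι t)] (hdense : FiberDense 𝒜 μ c) (h𝒜 : IsSetAlgebra 𝒜)
    (hc : ∀ t i, c t ⁻¹' {i} ∈ 𝒜) (habs : UniformAbsCont 𝒜 ν μ) : FiberDense 𝒜 (μ + ν) c := by
  intro E hE ε hε
  obtain ⟨δ, hδ, hδν⟩ := habs (ε / 2) (half_pos hε)
  obtain ⟨t, T, hT⟩ := hdense E hE (min δ (ε / 2)) (lt_min hδ (half_pos hε))
  have hmem : symmDiff E (c t ⁻¹' T) ∈ 𝒜 :=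
    symmDiff_mem_of_isSetAlgebra h𝒜 hE (preimage_mem_of_fiber_mem h𝒜 (hc t) T)
  refine ⟨t, T, ?_⟩
  calc (μ + ν) (symmDiff E (c t ⁻¹' T)) < ε / 2 + ε / 2 :=
        add_lt_add (hT.trans_le (min_le_right _ _))
          (hδν _ hmem (hT.trans_le (min_le_left _ _)))
    _ = ε := add_halves ε

variable [∀ t, Fintype (ι t)]

theorem IsRefining.monotone_densityEnergy (hc : IsRefining 𝒜 c) (h𝒜 : IsSetAlgebra 𝒜)
    (hμ : IsCharge 𝒜 μ) (hν : IsCharge 𝒜 ν) (hle : ∀ E ∈ 𝒜, ν E ≤ μ E) :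
    Monotone fun t => densityEnergy μ ν (c t) := by
  intro s t hst
  obtain ⟨g, hg⟩ := hc.exists_eq_comp s t hst
  simpa only [hg] using densityEnergy_comp_le hμ hν h𝒜 hle (hc.fiber_mem t) g

theorem IsRefining.sq_densityDefect_sub_le (hc : IsRefining 𝒜 c) (h𝒜 : IsSetAlgebra 𝒜)
    (hμ : IsCharge 𝒜 μ) (hν : IsCharge 𝒜 ν) (hle : ∀ E ∈ 𝒜, ν E ≤ μ E) (hE : E ∈ 𝒜) (s t : ℕ) :
    (densityDefect μ ν (c s) E - densityDefect μ ν (c t) E) ^ 2 ≤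
      μ univ * |densityEnergy μ ν (c s) - densityEnergy μ ν (c t)| := by
  wlog hst : s ≤ t generalizing s t
  · rw [sub_sq_comm, abs_sub_comm]
    exact this t s (le_of_not_ge hst)
  obtain ⟨g, hg⟩ := hc.exists_eq_comp s t hst
  rw [sub_sq_comm, hg]
  refine (sq_densityDefect_sub_comp_le hμ hν h𝒜 hle (hc.fiber_mem t) g hE).trans ?_
  gcongr
  · exact hμ.nonneg _ h𝒜.univ_mem
  · rw [abs_sub_comm]
    exact le_abs_self _

theorem IsRefining.uniformCauchySeqOn_densityDefect (hc : IsRefining 𝒜 c) (h𝒜 : IsSetAlgebra 𝒜)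
    (hμ : IsCharge 𝒜 μ) (hν : IsCharge 𝒜 ν) (hle : ∀ E ∈ 𝒜, ν E ≤ μ E) :
    UniformCauchySeqOn (fun t => densityDefect μ ν (c t)) atTop 𝒜 := by
  have hcauchy : CauchySeq fun t => densityEnergy μ ν (c t) :=
    (tendsto_atTop_ciSup (hc.monotone_densityEnergy h𝒜 hμ hν hle)
      ⟨μ univ, forall_mem_range.2 fun t =>
        densityEnergy_le hμ hν h𝒜 hle (hc.fiber_mem t)⟩).cauchySeq
  have hM : 0 < μ univ + 1 := by linarith [hμ.nonneg _ h𝒜.univ_mem]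
  refine Metric.uniformCauchySeqOn_iff.2 fun ε hε => ?_
  obtain ⟨N, hN⟩ := Metric.cauchySeq_iff.1 hcauchy (ε ^ 2 / (μ univ + 1)) (by positivity)
  refine ⟨N, fun s hs t ht E hE => abs_lt_of_sq_lt_sq ?_ hε.le⟩
  calc (densityDefect μ ν (c s) E - densityDefect μ ν (c t) E) ^ 2
      ≤ μ univ * |densityEnergy μ ν (c s) - densityEnergy μ ν (c t)| :=
        hc.sq_densityDefect_sub_le h𝒜 hμ hν hle hE s t
    _ ≤ (μ univ + 1) * |densityEnergy μ ν (c s) - densityEnergy μ ν (c t)| := by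
        gcongr
        linarith
    _ < ε ^ 2 := (lt_div_iff₀' hM).1 (hN s hs t ht)

theorem IsRefining.densityDefect_preimage (hc : IsRefining 𝒜 c) (h𝒜 : IsSetAlgebra 𝒜)
    (hμ : IsCharge 𝒜 μ) (hν : IsCharge 𝒜 ν) (hle : ∀ E ∈ 𝒜, ν E ≤ μ E) {s t : ℕ} (hst : s ≤ t)
    (T : Set (ι s)) : densityDefect μ ν (c t) (c s ⁻¹' T) = 0 := by
  obtain ⟨g, hg⟩ := hc.exists_eq_comp s t hst
  rw [hg, preimage_comp]
  exact _root_.densityDefect_preimage hμ hν h𝒜 hle (hc.fiber_mem t) _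

theorem IsRefining.exists_tendstoUniformlyOn_densityDefect (hc : IsRefining 𝒜 c)
    (h𝒜 : IsSetAlgebra 𝒜) (hμ : IsCharge 𝒜 μ) (hν : IsCharge 𝒜 ν) (hle : ∀ E ∈ 𝒜, ν E ≤ μ E) :
    ∃ D : Set X → ℝ, AdditiveOn 𝒜 D ∧ (∀ F ∈ 𝒜, |D F| ≤ μ F) ∧ (∀ t T, D (c t ⁻¹' T) = 0) ∧
      TendstoUniformlyOn (fun t => densityDefect μ ν (c t)) D atTop 𝒜 := by
  have hcauchy := hc.uniformCauchySeqOn_densityDefect h𝒜 hμ hν hle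
  set D : Set X → ℝ := fun F => limUnder atTop fun t => densityDefect μ ν (c t) F
  have hlim (F) (hF : F ∈ 𝒜) : Tendsto (fun t => densityDefect μ ν (c t) F) atTop (𝓝 (D F)) :=
    (hcauchy.cauchySeq hF).tendsto_limUnder
  refine ⟨D, fun E hE F hF hEF => ?_, fun F hF => ?_, fun s T => ?_,
    hcauchy.tendstoUniformlyOn_of_tendsto hlim⟩
  · refine tendsto_nhds_unique (hlim _ (h𝒜.union_mem hE hF)) ?_
    refine ((hlim E hE).add (hlim F hF)).congr fun t => ?_
    exact (hμ.additiveOn.densityDefect hν.additiveOn h𝒜 (hc.fiber_mem t) E hE F hF hEF).symm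
  · exact le_of_tendsto' (hlim F hF).abs fun t =>
      abs_densityDefect_le hμ hν h𝒜 hle (hc.fiber_mem t) hF
  · refine tendsto_nhds_unique (hlim _ (preimage_mem_of_fiber_mem h𝒜 (hc.fiber_mem s) T)) ?_
    refine tendsto_const_nhds.congr' ?_
    filter_upwards [eventually_ge_atTop s] with t hst
    exact (hc.densityDefect_preimage h𝒜 hμ hν hle hst T).symm

theorem FiberDense.tendstoUniformlyOn_densityDefect (hdense : FiberDense 𝒜 μ c)
    (hc : IsRefining 𝒜 c) (h𝒜 : IsSetAlgebra 𝒜) (hμ : IsCharge 𝒜 μ) (hν : IsCharge 𝒜 ν)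
    (hle : ∀ E ∈ 𝒜, ν E ≤ μ E) :
    TendstoUniformlyOn (fun t => densityDefect μ ν (c t)) 0 atTop 𝒜 := by
  obtain ⟨D, hD, hDμ, hD₀, hlim⟩ := hc.exists_tendstoUniformlyOn_densityDefect h𝒜 hμ hν hle
  exact hlim.congr_right fun E hE => hdense.eq_zero hμ.additiveOn hD h𝒜 hc.fiber_mem hDμ hD₀ hE

theorem densityDefect_inter_self {ι : Type*} [Fintype ι] {c : X → ι} (hμ : AdditiveOn 𝒜 μ)
    (h𝒜 : IsSetAlgebra 𝒜) (hc : ∀ i, c ⁻¹' {i} ∈ 𝒜) (hE : E ∈ 𝒜) :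
    densityDefect μ (fun F => μ (F ∩ E)) c E =
      ∑ i, (1 - cellDensity μ (fun F => μ (F ∩ E)) c i) * μ (E ∩ c ⁻¹' {i}) := by
  simp only [sub_mul, one_mul, Finset.sum_sub_distrib, hμ.sum_inter_fiber_univ h𝒜 hc hE,
    densityDefect, inter_self]

-- On a cell of density `d`, the better of the two approximations of `E`, by the cell and by `∅`,
-- has relative error `min d (1 - d) ≤ 2 * d * (1 - d)`.
theorem exists_symmDiff_preimage_le {ι : Type*} [Fintype ι] {c : X → ι} (hμ : IsCharge 𝒜 μ)
    (h𝒜 : IsSetAlgebra 𝒜) (hc : ∀ i, c ⁻¹' {i} ∈ 𝒜) (hE : E ∈ 𝒜) :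
    ∃ T : Set ι, μ (symmDiff E (c ⁻¹' T)) ≤ 2 * densityDefect μ (fun F => μ (F ∩ E)) c E := by
  have hν : IsCharge 𝒜 fun F => μ (F ∩ E) := hμ.restrict h𝒜 hE
  have hle (F) (hF : F ∈ 𝒜) : μ (F ∩ E) ≤ μ F :=
    hμ.mono h𝒜 (h𝒜.inter_mem hF hE) hF inter_subset_left
  set d := cellDensity μ (fun F => μ (F ∩ E)) c
  have hd (i : ι) : d i * μ (c ⁻¹' {i}) = μ (c ⁻¹' {i} ∩ E) := cellDensity_mul hν hle (hc i)
  have hd₀ (i : ι) : 0 ≤ d i := cellDensity_nonneg hμ hν (hc i)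
  have hd₁ (i : ι) : d i ≤ 1 := cellDensity_le_one hμ hle (hc i)
  have hcell (i : ι) : 0 ≤ μ (c ⁻¹' {i}) := hμ.nonneg _ (hc i)
  set T : Set ι := {i | 1 / 2 ≤ d i}
  have hT : c ⁻¹' T ∈ 𝒜 := preimage_mem_of_fiber_mem h𝒜 hc T
  refine ⟨T, ?_⟩
  rw [densityDefect_inter_self hμ.additiveOn h𝒜 hc hE, ← hμ.additiveOn.sum_inter_fiber_univ h𝒜 hc
    (symmDiff_mem_of_isSetAlgebra h𝒜 hE hT), Finset.mul_sum]
  refine Finset.sum_le_sum fun i _ => ?_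
  rw [inter_comm E, ← hd i]
  by_cases hi : i ∈ T
  · have herror : symmDiff E (c ⁻¹' T) ∩ c ⁻¹' {i} = c ⁻¹' {i} \ E := by
      ext x; grind
    have hsplit := hμ.additiveOn.inter_add_sdiff h𝒜 (hc i) hE
    have hhalf : 1 / 2 ≤ d i := hi
    rw [herror]
    nlinarith [hd i, mul_nonneg (mul_nonneg (sub_nonneg.2 hhalf) (sub_nonneg.2 (hd₁ i))) (hcell i)]
  · have herror : symmDiff E (c ⁻¹' T) ∩ c ⁻¹' {i} = c ⁻¹' {i} ∩ E := by
      ext x; grind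
    have hhalf : d i < 1 / 2 := not_le.1 hi
    rw [herror, ← hd i]
    nlinarith [mul_nonneg (mul_nonneg (hd₀ i) (sub_nonneg.2 hhalf.le)) (hcell i)]

end Refining

section FinAddProb

variable {𝒜 𝒢 : Set (Set BinPath)} {P Q p μ D : Set BinPath → ℝ} {E : Set BinPath}

theorem isSetAlgebra_events (Sig : MeasurableSpace BinPath) : IsSetAlgebra (events Sig) where
  empty_mem := MeasurableSet.empty
  compl_mem _ hE := MeasurableSet.compl hE
  union_mem _ _ hE hF := MeasurableSet.union hE hF

theorem IsFinAddProb.isCharge (hP : IsFinAddProb 𝒜 P) : IsCharge 𝒜 P :=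
  ⟨hP.nonneg, hP.union_eq⟩

theorem IsCharge.isFinAddProb_indicator (hμ : IsCharge 𝒜 μ) (h𝒜 : IsSetAlgebra 𝒜)
    (huniv : μ univ = 1) : IsFinAddProb 𝒜 (𝒜.indicator μ) where
  nonneg E hE := by simpa only [indicator_of_mem hE] using hμ.nonneg E hE
  univ_eq_one := by rw [indicator_of_mem h𝒜.univ_mem, huniv]
  union_eq E hE F hF hEF := by
    rw [indicator_of_mem (h𝒜.union_mem hE hF), indicator_of_mem hE, indicator_of_mem hF,
      hμ.additiveOn E hE F hF hEF]
  eq_zero_of_notMem _ hE := indicator_of_notMem hE μ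

theorem indicator_add_mem_extensions (hP : P ∈ extensions p 𝒢 𝒜) (h𝒜 : IsSetAlgebra 𝒜)
    (h𝒢 : 𝒢 ⊆ 𝒜) (hD : AdditiveOn 𝒜 D) (hDP : ∀ F ∈ 𝒜, |D F| ≤ P F) (hDuniv : D univ = 0)
    (hD𝒢 : ∀ G ∈ 𝒢, D G = 0) : 𝒜.indicator (P + D) ∈ extensions p 𝒢 𝒜 := by
  have hcharge : IsCharge 𝒜 (P + D) :=
    { nonneg := fun F hF => neg_le_iff_add_nonneg'.1 (abs_le.1 (hDP F hF)).1
      additiveOn := fun E hE F hF hEF => by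
        simp only [Pi.add_apply, hP.1.union_eq E hE F hF hEF, hD E hE F hF hEF]
        ring }
  refine ⟨hcharge.isFinAddProb_indicator h𝒜 ?_, fun G hG => ?_⟩
  · rw [Pi.add_apply, hDuniv, add_zero, hP.1.univ_eq_one]
  · rw [indicator_of_mem (h𝒢 hG), Pi.add_apply, hD𝒢 G hG, add_zero, hP.2 G hG]

theorem eq_zero_of_mem_extremePoints_extensions (hP : P ∈ (extensions p 𝒢 𝒜).extremePoints ℝ)
    (h𝒜 : IsSetAlgebra 𝒜) (h𝒢 : 𝒢 ⊆ 𝒜) (hD : AdditiveOn 𝒜 D) (hDP : ∀ F ∈ 𝒜, |D F| ≤ P F)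
    (hDuniv : D univ = 0) (hD𝒢 : ∀ G ∈ 𝒢, D G = 0) (hE : E ∈ 𝒜) : D E = 0 := by
  have hadd : 𝒜.indicator (P + D) ∈ extensions p 𝒢 𝒜 :=
    indicator_add_mem_extensions hP.1 h𝒜 h𝒢 hD hDP hDuniv hD𝒢
  have hsub : 𝒜.indicator (P + -D) ∈ extensions p 𝒢 𝒜 := by
    refine indicator_add_mem_extensions hP.1 h𝒜 h𝒢 (fun E hE F hF hEF => ?_) (fun F hF => ?_)
      (neg_eq_zero.2 hDuniv) fun G hG => neg_eq_zero.2 (hD𝒢 G hG)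
    · simp only [Pi.neg_apply, hD E hE F hF hEF, neg_add]
    · simpa only [Pi.neg_apply, abs_neg] using hDP F hF
  have hmid : P ∈ openSegment ℝ (𝒜.indicator (P + D)) (𝒜.indicator (P + -D)) := by
    refine ⟨1 / 2, 1 / 2, by norm_num, by norm_num, by norm_num, ?_⟩
    ext F
    by_cases hF : F ∈ 𝒜
    · simp only [Pi.add_apply, Pi.smul_apply, indicator_of_mem hF, Pi.neg_apply, smul_eq_mul]
      ring
    · simp [indicator_of_notMem hF, hP.1.1.eq_zero_of_notMem F hF]
  have heq := congrFun (hP.2 hadd hsub hmid) E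
  rwa [indicator_of_mem hE, Pi.add_apply, add_eq_left] at heq

end FinAddProb

section History

variable {𝒜 𝒢 : Set (Set BinPath)} {P p : Set BinPath → ℝ}

/-- The outcomes of the first `t` periods. Its fibres are the cylinders of length `t`. -/
def history (t : ℕ) (ω : BinPath) : Fin t → Bool := fun i => ω i

theorem history_preimage_history (t : ℕ) (ω : BinPath) :
    history t ⁻¹' {history t ω} = cyl ω t := by
  ext η
  simp only [mem_preimage, mem_singleton_iff, funext_iff, history, PiNat.mem_cylinder_iff,
    Fin.forall_iff]

theorem history_surjective (t : ℕ) : Function.Surjective (history t) := fun w =>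
  ⟨fun i => if h : i < t then w ⟨i, h⟩ else false, funext fun i => by simp [history]⟩

theorem history_fiber_mem_cylinders (t : ℕ) (w : Fin t → Bool) :
    history t ⁻¹' {w} ∈ cylinders := by
  obtain ⟨ω, rfl⟩ := history_surjective t w
  exact ⟨ω, t, history_preimage_history t ω⟩

theorem isRefining_history (hcyl : cylinders ⊆ 𝒜) : IsRefining 𝒜 history where
  fiber_mem t w := hcyl (history_fiber_mem_cylinders t w)
  exists_eq_comp _ _ hst := ⟨fun w i => w (Fin.castLE hst i), rfl⟩

theorem fiberDense_of_mem_extremePoints_extensions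
    (hP : P ∈ (extensions p 𝒢 𝒜).extremePoints ℝ) (h𝒜 : IsSetAlgebra 𝒜) (h𝒢 : 𝒢 ⊆ 𝒜)
    (hcyl : cylinders ⊆ 𝒜) (hnull : ∀ G ∈ 𝒢, G ∈ cylinders ∨ P G = 0) :
    FiberDense 𝒜 P history := by
  intro E hE ε hε
  have hμ : IsCharge 𝒜 P := hP.1.1.isCharge
  obtain ⟨D, hD, hDP, hD₀, hlim⟩ :=
    (isRefining_history hcyl).exists_tendstoUniformlyOn_densityDefect h𝒜 hμ (hμ.restrict h𝒜 hE)
      fun F hF => hμ.mono h𝒜 (h𝒜.inter_mem hF hE) hF inter_subset_left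
  have hD𝒢 (G) (hG : G ∈ 𝒢) : D G = 0 := by
    obtain ⟨ω, t, rfl⟩ | hPG := hnull G hG
    · rw [← history_preimage_history, hD₀]
    · exact abs_nonpos_iff.1 (hPG ▸ hDP G (h𝒢 hG))
  have hDE : D E = 0 := eq_zero_of_mem_extremePoints_extensions hP h𝒜 h𝒢 hD hDP
    (by simpa using hD₀ 0 univ) hD𝒢 hE
  obtain ⟨t, ht⟩ := ((hDE ▸ hlim.tendsto_at hE).eventually_lt_const (half_pos hε)).exists
  obtain ⟨T, hT⟩ := exists_symmDiff_preimage_le hμ h𝒜 ((isRefining_history hcyl).fiber_mem t) hE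
  exact ⟨t, T, by linarith⟩

end History

section Merging

variable {X : Type*} {𝒜 : Set (Set X)} {P Q : Set X → ℝ} {ε : ℝ}

-- For a cell of masses `p`, `q` under `P`, `Q`, and a part of it of masses `a`, `b`, the right-hand
-- side is the contribution of that part to `densityDefect (P + Q) Q`. The gap between `b / q` and
-- `a / p` is cross-multiplied so that null cells need no special treatment.
theorem half_mul_min_le_sub_div {p q a b : ℝ} (hε : 0 ≤ ε) (hp : 0 ≤ p) (hq : 0 ≤ q)
    (hb : 0 ≤ b) (hgap : ε * (p * q) ≤ p * b - q * a) :
    ε / 2 * min p q ≤ b - q / (p + q) * (a + b) := by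
  obtain hpq | hpq := (add_nonneg hp hq).eq_or_lt
  · have hp₀ : p = 0 := by linarith
    have hq₀ : q = 0 := by linarith
    simpa [hp₀, hq₀] using hb
  have hmin : min p q / 2 * (p + q) ≤ p * q := by
    nlinarith [min_mul_max p q, min_add_max p q, min_le_max (a := p) (b := q), le_min hp hq]
  have hterm : b - q / (p + q) * (a + b) = (p * b - q * a) / (p + q) := by
    field_simp
    ring
  rw [hterm, le_div_iff₀ hpq]
  linarith [mul_le_mul_of_nonneg_left hmin hε]

theorem exists_half_mul_sum_min_le_densityDefect {ι : Type*} [Fintype ι] {c : X → ι}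
    (h𝒜 : IsSetAlgebra 𝒜) (hP : IsCharge 𝒜 P) (hQ : IsCharge 𝒜 Q)
    (hc : ∀ i, c ⁻¹' {i} ∈ 𝒜) (hε : 0 ≤ ε) (T : Finset ι)
    (hgap : ∀ i ∈ T, ∃ F ∈ 𝒜, ε * (P (c ⁻¹' {i}) * Q (c ⁻¹' {i})) ≤
      P (c ⁻¹' {i}) * Q (F ∩ c ⁻¹' {i}) - Q (c ⁻¹' {i}) * P (F ∩ c ⁻¹' {i})) :
    ∃ E ∈ 𝒜, ε / 2 * ∑ i ∈ T, min (P (c ⁻¹' {i})) (Q (c ⁻¹' {i})) ≤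
      densityDefect (P + Q) Q c E := by
  choose! F hF hgap using hgap
  have hFc (i : ι) (hi : i ∈ T) : F i ∩ c ⁻¹' {i} ∈ 𝒜 := h𝒜.inter_mem (hF i hi) (hc i)
  refine ⟨⋃ i ∈ T, F i ∩ c ⁻¹' {i}, h𝒜.biUnion_mem T hFc, ?_⟩
  rw [densityDefect_biUnion_inter_fiber (hP.add hQ).additiveOn hQ.additiveOn h𝒜 hc T hFc,
    Finset.mul_sum]
  exact Finset.sum_le_sum fun i hi => half_mul_min_le_sub_div hε (hP.nonneg _ (hc i))
    (hQ.nonneg _ (hc i)) (hQ.nonneg _ (hFc i hi)) (hgap i hi)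

variable {ι : ℕ → Type*} [∀ t, Finite (ι t)] {c : ∀ t, X → ι t}

theorem IsRefining.tendsto_sum_min (hc : IsRefining 𝒜 c) (h𝒜 : IsSetAlgebra 𝒜)
    (hP : IsCharge 𝒜 P) (hQ : IsCharge 𝒜 Q) (hdense : FiberDense 𝒜 (P + Q) c) (hε : 0 < ε)
    (T : ∀ t, Finset (ι t))
    (hgap : ∀ t, ∀ i ∈ T t, ∃ F ∈ 𝒜, ε * (P (c t ⁻¹' {i}) * Q (c t ⁻¹' {i})) ≤
      P (c t ⁻¹' {i}) * Q (F ∩ c t ⁻¹' {i}) - Q (c t ⁻¹' {i}) * P (F ∩ c t ⁻¹' {i})) :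
    Tendsto (fun t => ∑ i ∈ T t, min (P (c t ⁻¹' {i})) (Q (c t ⁻¹' {i}))) atTop (𝓝 0) := by
  have hfintype (t : ℕ) : Fintype (ι t) := Fintype.ofFinite (ι t)
  have hdefect : TendstoUniformlyOn (fun t => densityDefect (P + Q) Q (c t)) 0 atTop 𝒜 :=
    hdense.tendstoUniformlyOn_densityDefect hc h𝒜 (hP.add hQ) hQ fun F hF =>
      le_add_of_nonneg_left (hP.nonneg F hF)
  choose E hE hgapE using fun t =>
    exists_half_mul_sum_min_le_densityDefect h𝒜 hP hQ (hc.fiber_mem t) hε.le (T t) (hgap t)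
  have hnonneg (t : ℕ) : 0 ≤ ∑ i ∈ T t, min (P (c t ⁻¹' {i})) (Q (c t ⁻¹' {i})) :=
    Finset.sum_nonneg fun i _ =>
      le_min (hP.nonneg _ (hc.fiber_mem t i)) (hQ.nonneg _ (hc.fiber_mem t i))
  refine Metric.tendsto_atTop.2 fun η hη => ?_
  obtain ⟨N, hN⟩ := eventually_atTop.1
    (Metric.tendstoUniformlyOn_iff.1 hdefect (ε / 2 * η) (by positivity))
  refine ⟨N, fun t ht => ?_⟩
  have hsmall := hN t ht (E t) (hE t)
  rw [Pi.zero_apply, dist_zero_left, Real.norm_eq_abs] at hsmall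
  rw [dist_zero_right, Real.norm_of_nonneg (hnonneg t)]
  exact lt_of_mul_lt_mul_left ((hgapE t).trans_lt ((le_abs_self _).trans_lt hsmall))
    (half_pos hε).le

-- The minimum controls `Q` itself where `Q ≤ P`, and `P` elsewhere, where `Q` is then small by
-- absolute continuity.
theorem UniformAbsCont.tendsto_preimage (habs : UniformAbsCont 𝒜 Q P) (h𝒜 : IsSetAlgebra 𝒜)
    (hP : IsCharge 𝒜 P) (hQ : IsCharge 𝒜 Q) (hc : ∀ t i, c t ⁻¹' {i} ∈ 𝒜) (T : ∀ t, Finset (ι t))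
    (hmin : Tendsto (fun t => ∑ i ∈ T t, min (P (c t ⁻¹' {i})) (Q (c t ⁻¹' {i}))) atTop (𝓝 0)) :
    Tendsto (fun t => Q (c t ⁻¹' T t)) atTop (𝓝 0) := by
  classical
  have hmem (t : ℕ) (S : Set (ι t)) : c t ⁻¹' S ∈ 𝒜 := preimage_mem_of_fiber_mem h𝒜 (hc t) S
  refine Metric.tendsto_nhds.2 fun η hη => ?_
  obtain ⟨δ, hδ, hδη⟩ := habs (η / 2) (half_pos hη)
  filter_upwards [hmin.eventually_lt_const (lt_min hδ (half_pos hη))] with t ht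
  set T₁ := {i ∈ T t | Q (c t ⁻¹' {i}) ≤ P (c t ⁻¹' {i})}
  set T₂ := {i ∈ T t | ¬ Q (c t ⁻¹' {i}) ≤ P (c t ⁻¹' {i})}
  have hsum : Q (c t ⁻¹' T₁) + P (c t ⁻¹' T₂) =
      ∑ i ∈ T t, min (P (c t ⁻¹' {i})) (Q (c t ⁻¹' {i})) := by
    rw [← hQ.additiveOn.sum_fiber h𝒜 (hc t), ← hP.additiveOn.sum_fiber h𝒜 (hc t),
      ← Finset.sum_filter_add_sum_filter_not (T t) fun i => Q (c t ⁻¹' {i}) ≤ P (c t ⁻¹' {i})]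
    congr 1 <;> refine Finset.sum_congr rfl fun i hi => ?_
    · exact (min_eq_right (Finset.mem_filter.1 hi).2).symm
    · exact (min_eq_left (not_le.1 (Finset.mem_filter.1 hi).2).le).symm
  have hsplit : Q (c t ⁻¹' T t) = Q (c t ⁻¹' T₁) + Q (c t ⁻¹' T₂) := by
    simp only [← hQ.additiveOn.sum_fiber h𝒜 (hc t)]
    exact (Finset.sum_filter_add_sum_filter_not _ _ _).symm
  have hQT₁ : Q (c t ⁻¹' T₁) < η / 2 := by
    linarith [min_le_right δ (η / 2), hP.nonneg _ (hmem t T₂)]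
  have hQT₂ : Q (c t ⁻¹' T₂) < η / 2 := by
    refine hδη _ (hmem t T₂) ?_
    linarith [min_le_left δ (η / 2), hQ.nonneg _ (hmem t T₁)]
  rw [dist_zero_right, Real.norm_of_nonneg (hQ.nonneg _ (hmem t _)), hsplit]
  linarith

end Merging

section BlackwellDubins

variable {Sig : MeasurableSpace BinPath} {P Q : Set BinPath → ℝ}

theorem AbsCont.uniformAbsCont (habs : AbsCont Sig Q P) (hP : IsCharge (events Sig) P) :
    UniformAbsCont (events Sig) Q P := by
  intro ε hε
  by_contra! hcon
  choose F hF hPF hQF using fun n : ℕ => hcon (1 / (n + 1)) Nat.one_div_pos_of_nat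
  have hP_lim : Tendsto (fun n => P (F n)) atTop (𝓝 0) :=
    squeeze_zero (fun n => hP.nonneg _ (hF n)) (fun n => (hPF n).le)
      tendsto_one_div_add_atTop_nhds_zero_nat
  exact hε.not_ge (ge_of_tendsto' (habs F hF hP_lim) hQF)

theorem exists_gap_of_lt_abs_condProb_sub {𝒜 : Set (Set BinPath)} {E C : Set BinPath} {ε : ℝ}
    (h𝒜 : IsSetAlgebra 𝒜) (hP : IsCharge 𝒜 P) (hQ : IsCharge 𝒜 Q) (hE : E ∈ 𝒜) (hC : C ∈ 𝒜)
    (hε : ε < |condProb P E C - condProb Q E C|) :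
    ∃ F ∈ 𝒜, ε * (P C * Q C) ≤ P C * Q (F ∩ C) - Q C * P (F ∩ C) := by
  by_cases hnull : P C * Q C = 0
  · exact ⟨∅, h𝒜.empty_mem, by simp [hnull, hP.additiveOn.empty h𝒜, hQ.additiveOn.empty h𝒜]⟩
  obtain ⟨hPC, hQC⟩ := mul_ne_zero_iff.1 hnull
  have hpos : 0 ≤ P C * Q C := mul_nonneg (hP.nonneg C hC) (hQ.nonneg C hC)
  have hPE : P (E ∩ C) = condProb P E C * P C := (div_mul_cancel₀ _ hPC).symm
  have hQE : Q (E ∩ C) = condProb Q E C * Q C := (div_mul_cancel₀ _ hQC).symm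
  obtain hlt | hlt := lt_abs.1 hε
  · have hPE' := hP.additiveOn.inter_add_sdiff h𝒜 hC hE
    have hQE' := hQ.additiveOn.inter_add_sdiff h𝒜 hC hE
    rw [inter_comm, sdiff_eq_compl_inter] at hPE' hQE'
    refine ⟨Eᶜ, h𝒜.compl_mem hE, ?_⟩
    linear_combination mul_le_mul_of_nonneg_right hlt.le hpos - P C * hQE' +
      Q C * hPE' + P C * hQE - Q C * hPE
  · refine ⟨E, hE, ?_⟩
    rw [hPE, hQE]
    linear_combination mul_le_mul_of_nonneg_right hlt.le hpos

theorem setOf_lt_forecastDist_eq_preimage (Sig : MeasurableSpace BinPath)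
    (P Q : Set BinPath → ℝ) (ε : ℝ) (t : ℕ) :
    {ω | ε < forecastDist Sig P Q ω t} =
      history t ⁻¹' (history t '' {ω | ε < forecastDist Sig P Q ω t}) := by
  refine (subset_preimage_image _ _).antisymm ?_
  rintro ω ⟨η, hη, hηω⟩
  rwa [mem_ofPred_eq, forecastDist, ← history_preimage_history, ← hηω, history_preimage_history]

theorem merges_of_fiberDense (hcyl : cylinders ⊆ events Sig) (hP : IsCharge (events Sig) P)
    (hQ : IsCharge (events Sig) Q) (hdense : FiberDense (events Sig) P history)
    (habs : AbsCont Sig Q P) : Merges Sig P Q := by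
  intro ε hε
  have h𝒜 := isSetAlgebra_events Sig
  have hc := isRefining_history hcyl
  have habs := habs.uniformAbsCont hP
  set T : ∀ t, Finset (Fin t → Bool) := fun t =>
    (toFinite (history t '' {ω | ε < forecastDist Sig P Q ω t})).toFinset
  have hT (t : ℕ) : {ω | ε < forecastDist Sig P Q ω t} = history t ⁻¹' T t := by
    rw [Finite.coe_toFinset, ← setOf_lt_forecastDist_eq_preimage]
  simp only [hT]
  refine habs.tendsto_preimage h𝒜 hP hQ hc.fiber_mem T ?_
  refine hc.tendsto_sum_min h𝒜 hP hQ (hdense.add h𝒜 hc.fiber_mem habs) hε T fun t w hw => ?_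
  obtain ⟨ω, hω : ε < forecastDist Sig P Q ω t, rfl⟩ := (Finite.mem_toFinset _).1 hw
  have hnonempty : Nonempty (events Sig) := ⟨⟨univ, h𝒜.univ_mem⟩⟩
  obtain ⟨⟨E, hE⟩, hεE⟩ := exists_lt_of_lt_ciSup hω
  rw [history_preimage_history]
  exact exists_gap_of_lt_abs_condProb_sub h𝒜 hP hQ hE (hcyl ⟨ω, t, rfl⟩) hεE

end BlackwellDubins

section Nonatomic

variable {X : Type*} {𝒜 : Set (Set X)} {μ : Set X → ℝ}

theorem IsCharge.union_le (hμ : IsCharge 𝒜 μ) (h𝒜 : IsSetAlgebra 𝒜) {E F : Set X} (hE : E ∈ 𝒜)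
    (hF : F ∈ 𝒜) : μ (E ∪ F) ≤ μ E + μ F := by
  rw [← union_sdiff_self, hμ.additiveOn E hE _ (h𝒜.sdiff_mem hF hE) disjoint_sdiff_right]
  gcongr
  exact hμ.mono h𝒜 (h𝒜.sdiff_mem hF hE) hF sdiff_subset

/-- A pair `A ⊆ B` of members of `𝒜` whose `μ`-values enclose the target value `r`. -/
structure IsEnclosure (𝒜 : Set (Set X)) (μ : Set X → ℝ) (r : ℝ) (A B : Set X) : Prop where
  left_mem : A ∈ 𝒜
  right_mem : B ∈ 𝒜
  subset : A ⊆ B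
  left_le : μ A ≤ r
  le_right : r ≤ μ B

theorem exists_finset_lt_le_insert {ι α : Type*} [DecidableEq ι] [LinearOrder α]
    {f : Finset ι → α} {r : α} {T : Finset ι} (hempty : f ∅ < r) (hT : r ≤ f T) :
    ∃ S i, f S < r ∧ r ≤ f (insert i S) := by
  induction T using Finset.induction with
  | empty => exact absurd hT hempty.not_ge
  | insert i S _ ih =>
    obtain hle | hlt := le_or_gt r (f S)
    · exact ih hle
    · exact ⟨S, i, hlt, hT⟩

theorem IsEnclosure.exists_refinement {ι : Type*} [Finite ι] {c : X → ι} {r ε : ℝ} {A B : Set X}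
    (hAB : IsEnclosure 𝒜 μ r A B) (hμ : IsCharge 𝒜 μ) (h𝒜 : IsSetAlgebra 𝒜)
    (hc : ∀ i, c ⁻¹' {i} ∈ 𝒜) (hε : 0 ≤ ε) (hmesh : ∀ i, μ (c ⁻¹' {i}) ≤ ε) :
    ∃ A' B', IsEnclosure 𝒜 μ r A' B' ∧ A ⊆ A' ∧ B' ⊆ B ∧ μ B' ≤ μ A' + ε := by
  classical
  obtain ⟨_⟩ := nonempty_fintype ι
  obtain heq | hlt := hAB.left_le.eq_or_lt
  · exact ⟨A, A, ⟨hAB.left_mem, hAB.left_mem, Subset.rfl, heq.le, heq.ge⟩, Subset.rfl,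
      hAB.subset, le_add_of_nonneg_right hε⟩
  set G : Finset ι → Set X := fun T => A ∪ B ∩ c ⁻¹' T
  have hG_empty : G ∅ = A := by simp [G]
  have hG_univ : G Finset.univ = B := by simp [G, union_eq_self_of_subset_left hAB.subset]
  have hG (T : Finset ι) : G T ∈ 𝒜 :=
    h𝒜.union_mem hAB.left_mem
      (h𝒜.inter_mem hAB.right_mem (preimage_mem_of_fiber_mem h𝒜 hc T))
  obtain ⟨T, i, hT, hiT⟩ := exists_finset_lt_le_insert (f := fun T => μ (G T))
    (by rwa [hG_empty]) (hAB.le_right.trans_eq (congrArg μ hG_univ.symm))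
  have hG_insert : G (insert i T) = G T ∪ B ∩ c ⁻¹' {i} := by
    simp only [G, Finset.coe_insert, insert_eq, preimage_union]
    rw [union_comm (c ⁻¹' {i}), inter_union_distrib_left, union_assoc]
  have hcell : B ∩ c ⁻¹' {i} ∈ 𝒜 := h𝒜.inter_mem hAB.right_mem (hc i)
  refine ⟨G T, G (insert i T), ⟨hG T, hG _, hG_insert ▸ subset_union_left, hT.le, hiT⟩,
    subset_union_left, union_subset hAB.subset inter_subset_left, ?_⟩
  calc μ (G (insert i T)) ≤ μ (G T) + μ (B ∩ c ⁻¹' {i}) :=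
        hG_insert ▸ hμ.union_le h𝒜 (hG T) hcell
    _ ≤ μ (G T) + ε := by
        gcongr
        exact (hμ.mono h𝒜 hcell (hc i) inter_subset_right).trans (hmesh i)

theorem IsEnclosure.exists_seq {ι : ℕ → Type*} [∀ t, Finite (ι t)] {c : ∀ t, X → ι t} {r : ℝ}
    {A B : Set X} (hAB : IsEnclosure 𝒜 μ r A B) (hμ : IsCharge 𝒜 μ) (h𝒜 : IsSetAlgebra 𝒜)
    (hc : ∀ t i, c t ⁻¹' {i} ∈ 𝒜) (hmesh : ∀ ε > 0, ∃ t, ∀ i, μ (c t ⁻¹' {i}) ≤ ε) :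
    ∃ A' B' : ℕ → Set X, Monotone A' ∧ Antitone B' ∧ B' 0 ⊆ B ∧
      ∀ n : ℕ, IsEnclosure 𝒜 μ r (A' n) (B' n) ∧ μ (B' n) ≤ μ (A' n) + 1 / (n + 1) := by
  have hnext (n : ℕ) (p : {p : Set X × Set X // IsEnclosure 𝒜 μ r p.1 p.2}) :
      ∃ q : {p : Set X × Set X // IsEnclosure 𝒜 μ r p.1 p.2},
        p.1.1 ⊆ q.1.1 ∧ q.1.2 ⊆ p.1.2 ∧ μ q.1.2 ≤ μ q.1.1 + 1 / (n + 1) := by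
    obtain ⟨t, ht⟩ := hmesh (1 / (n + 1)) Nat.one_div_pos_of_nat
    obtain ⟨A', B', hAB', hA, hB, hle⟩ :=
      p.2.exists_refinement hμ h𝒜 (hc t) Nat.one_div_pos_of_nat.le ht
    exact ⟨⟨(A', B'), hAB'⟩, hA, hB, hle⟩
  choose next hA hB hle using hnext
  let p (n : ℕ) : {p : Set X × Set X // IsEnclosure 𝒜 μ r p.1 p.2} :=
    n.rec (next 0 ⟨(A, B), hAB⟩) fun k q => next (k + 1) q
  refine ⟨fun n => (p n).1.1, fun n => (p n).1.2, monotone_nat_of_le_succ fun n => hA (n + 1) (p n),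
    antitone_nat_of_succ_le fun n => hB (n + 1) (p n), hB 0 _, fun n => ⟨(p n).2, ?_⟩⟩
  cases n with
  | zero => exact hle 0 _
  | succ k => exact hle (k + 1) (p k)

theorem IsCharge.exists_subset_apply_eq {ι : ℕ → Type*} [∀ t, Finite (ι t)] {c : ∀ t, X → ι t}
    {r : ℝ} {E : Set X} (hμ : IsCharge 𝒜 μ) (h𝒜 : IsSetAlgebra 𝒜)
    (hσ : ∀ A : ℕ → Set X, (∀ n, A n ∈ 𝒜) → (⋃ n, A n) ∈ 𝒜)
    (hc : ∀ t i, c t ⁻¹' {i} ∈ 𝒜) (hmesh : ∀ ε > 0, ∃ t, ∀ i, μ (c t ⁻¹' {i}) ≤ ε)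
    (hE : E ∈ 𝒜) (hr : 0 ≤ r) (hrE : r ≤ μ E) : ∃ F ∈ 𝒜, F ⊆ E ∧ μ F = r := by
  have hstart : IsEnclosure 𝒜 μ r ∅ E :=
    ⟨h𝒜.empty_mem, hE, empty_subset E, (hμ.additiveOn.empty h𝒜).trans_le hr, hrE⟩
  obtain ⟨A, B, hA, hB, hBE, hAB⟩ := hstart.exists_seq hμ h𝒜 hc hmesh
  have hF : (⋃ n, A n) ∈ 𝒜 := hσ A fun n => (hAB n).1.left_mem
  have hFB (n : ℕ) : ⋃ m, A m ⊆ B n := iUnion_subset fun m =>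
    (hA (le_max_left m n)).trans ((hAB _).1.subset.trans (hB (le_max_right m n)))
  refine ⟨⋃ n, A n, hF, (hFB 0).trans hBE, eq_of_forall_dist_le fun ε hε => ?_⟩
  obtain ⟨n, hn⟩ := exists_nat_one_div_lt hε
  have hlower := hμ.mono h𝒜 (hAB n).1.left_mem hF (subset_iUnion A n)
  have hupper := hμ.mono h𝒜 hF (hAB n).1.right_mem (hFB n)
  rw [Real.dist_eq, abs_le]
  constructor <;> linarith [(hAB n).1.left_le, (hAB n).1.le_right, (hAB n).2]

theorem stronglyNonatomic_of_apply_cyl {Sig : MeasurableSpace BinPath} {P : Set BinPath → ℝ}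
    (hcyl : cylinders ⊆ events Sig) (hP : IsCharge (events Sig) P)
    (hunif : ∀ ω t, P (cyl ω t) = (1 / 2) ^ t) : StronglyNonatomic Sig P := by
  intro E hE α hα
  refine hP.exists_subset_apply_eq (isSetAlgebra_events Sig) (fun A hA => MeasurableSet.iUnion hA)
    (isRefining_history hcyl).fiber_mem (fun ε hε => ?_) hE (mul_nonneg hα.1 (hP.nonneg E hE))
    (mul_le_of_le_one_left (hP.nonneg E hE) hα.2)
  obtain ⟨t, ht⟩ := exists_pow_lt_of_lt_one hε (one_half_lt_one (α := ℝ))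
  refine ⟨t, (history_surjective t).forall.2 fun ω => ?_⟩
  rw [history_preimage_history, hunif]
  exact ht.le

end Nonatomic

section Existence

variable {I 𝒜 𝒢 : Set (Set BinPath)} {P p : Set BinPath → ℝ}
  {C E F : Set BinPath}

theorem IsFinAddProb.mem_Icc (hP : IsFinAddProb 𝒜 P) (h𝒜 : IsSetAlgebra 𝒜) (E : Set BinPath) :
    P E ∈ Icc (0 : ℝ) 1 := by
  by_cases hE : E ∈ 𝒜
  · refine ⟨hP.nonneg E hE, hP.univ_eq_one ▸ ?_⟩
    exact hP.isCharge.mono h𝒜 hE h𝒜.univ_mem (subset_univ E)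
  · simp [hP.eq_zero_of_notMem E hE]

theorem IsFinAddProb.eq_zero_of_disjoint (hP : IsFinAddProb 𝒜 P) (h𝒜 : IsSetAlgebra 𝒜)
    (hE : E ∈ 𝒜) (hPE : P E = 1) (hF : F ∈ 𝒜) (hEF : Disjoint E F) : P F = 0 := by
  have hunion := hP.union_eq E hE F hF hEF
  linarith [hP.nonneg F hF, (hP.mem_Icc h𝒜 (E ∪ F)).2]

theorem isClosed_extensions (p : Set BinPath → ℝ) (𝒢 𝒜 : Set (Set BinPath)) :
    IsClosed (extensions p 𝒢 𝒜) := by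
  have heq : extensions p 𝒢 𝒜 = {Q | (∀ E ∈ 𝒜, 0 ≤ Q E) ∧ Q univ = 1 ∧
      (∀ E ∈ 𝒜, ∀ F ∈ 𝒜, Disjoint E F → Q (E ∪ F) = Q E + Q F) ∧
      (∀ E, E ∉ 𝒜 → Q E = 0) ∧ ∀ A ∈ 𝒢, Q A = p A} := by
    ext Q
    exact ⟨fun ⟨⟨h₁, h₂, h₃, h₄⟩, h₅⟩ => ⟨h₁, h₂, h₃, h₄, h₅⟩,
      fun ⟨h₁, h₂, h₃, h₄, h₅⟩ => ⟨⟨h₁, h₂, h₃, h₄⟩, h₅⟩⟩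
  rw [heq]
  simp only [ofPred_and, ofPred_forall]
  refine .inter (isClosed_biInter fun E _ => isClosed_le (by fun_prop) (by fun_prop)) <|
    .inter (isClosed_eq (by fun_prop) (by fun_prop)) <|
    .inter (isClosed_biInter fun E _ => isClosed_biInter fun F _ => isClosed_iInter fun _ =>
      isClosed_eq (by fun_prop) (by fun_prop)) <|
    .inter (isClosed_biInter fun E _ => isClosed_eq (by fun_prop) (by fun_prop)) <|
    isClosed_biInter fun A _ => isClosed_eq (by fun_prop) (by fun_prop)

theorem isCompact_extensions (p : Set BinPath → ℝ) (𝒢 : Set (Set BinPath))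
    (h𝒜 : IsSetAlgebra 𝒜) : IsCompact (extensions p 𝒢 𝒜) :=
  (isCompact_univ_pi fun _ => isCompact_Icc (a := (0 : ℝ)) (b := 1)).of_isClosed_subset
    (isClosed_extensions p 𝒢 𝒜) fun _ hQ E _ => hQ.1.mem_Icc h𝒜 E

theorem convex_extensions (p : Set BinPath → ℝ) (𝒢 𝒜 : Set (Set BinPath)) :
    Convex ℝ (extensions p 𝒢 𝒜) := by
  rintro P ⟨hP, hPp⟩ Q ⟨hQ, hQp⟩ a b ha hb hab
  refine ⟨⟨fun E hE => ?_, ?_, fun E hE F hF hEF => ?_, fun E hE => ?_⟩, fun A hA => ?_⟩ <;>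
    simp only [Pi.add_apply, Pi.smul_apply, smul_eq_mul]
  · exact add_nonneg (mul_nonneg ha (hP.nonneg E hE)) (mul_nonneg hb (hQ.nonneg E hE))
  · rw [hP.univ_eq_one, hQ.univ_eq_one, mul_one, mul_one, hab]
  · rw [hP.union_eq E hE F hF hEF, hQ.union_eq E hE F hF hEF]
    ring
  · rw [hP.eq_zero_of_notMem E hE, hQ.eq_zero_of_notMem E hE, mul_zero, mul_zero, add_zero]
  · rw [hPp A hA, hQp A hA, ← add_mul, hab, one_mul]

-- The empty collection is a strictly proper ideal, but `Filter.comk` needs `∅` to be small.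
theorem IsStrictlyProperIdeal.insert_empty (hI : IsStrictlyProperIdeal I) :
    IsStrictlyProperIdeal (insert ∅ I) where
  mem_of_subset := by
    rintro S (rfl | hS) R hRS
    · exact .inl (subset_empty_iff.1 hRS)
    · exact .inr (hI.mem_of_subset S hS R hRS)
  union_mem := by
    rintro R (rfl | hR) S hS
    · rwa [empty_union]
    · obtain rfl | hS := hS
      · rw [union_empty]
        exact .inr hR
      · exact .inr (hI.union_mem R hR S hS)
  cylinder_notMem := by
    rintro C ⟨ω, t, rfl⟩ (h | h)
    · exact (h ▸ PiNat.self_mem_cylinder ω t : ω ∈ (∅ : Set BinPath))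
    · exact hI.cylinder_notMem _ ⟨ω, t, rfl⟩ h

theorem IsStrictlyProperIdeal.exists_ultrafilter (hI : IsStrictlyProperIdeal I)
    (hC : C ∈ cylinders) : ∃ U : Ultrafilter BinPath, C ∈ U ∧ ∀ E ∈ I, E ∉ U := by
  have hI' := hI.insert_empty
  set f : Filter BinPath := Filter.comk (· ∈ insert ∅ I) (mem_insert ∅ I)
    (fun S hS R hRS => hI'.mem_of_subset S hS R hRS) fun R hR S hS => hI'.union_mem R hR S hS
  have hf : (f ⊓ 𝓟 C).NeBot := by
    refine inf_principal_neBot_iff.2 fun U hU => inter_comm C U ▸ ?_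
    by_contra hempty
    rw [not_nonempty_iff_eq_empty, ← disjoint_iff_inter_eq_empty] at hempty
    exact hI'.cylinder_notMem C hC (hI'.mem_of_subset _ hU C hempty.subset_compl_right)
  refine ⟨Ultrafilter.of (f ⊓ 𝓟 C), ?_, fun E hE hEU => ?_⟩
  · exact Ultrafilter.of_le _ (mem_inf_of_right (mem_principal_self C))
  · have hEc : Eᶜ ∈ f := compl_mem_comk.2 (mem_insert_of_mem ∅ hE)
    exact Ultrafilter.compl_mem_iff_notMem.1 (Ultrafilter.of_le _ (mem_inf_of_left hEc)) hEU

theorem isCharge_indicator_ultrafilter {X : Type*} (𝒜 : Set (Set X)) (U : Ultrafilter X) :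
    IsCharge 𝒜 ({E | E ∈ U}.indicator 1) where
  nonneg E _ := indicator_nonneg (fun _ _ => zero_le_one) E
  additiveOn E _ F _ hEF := by
    have hnot : ¬(E ∈ U ∧ F ∈ U) := fun ⟨hEU, hFU⟩ =>
      U.empty_notMem (disjoint_iff_inter_eq_empty.1 hEF ▸ inter_mem hEU hFU)
    by_cases hEU : E ∈ U <;> by_cases hFU : F ∈ U <;>
      simp_all [indicator, Ultrafilter.union_mem_iff]

theorem IsStrictlyProperIdeal.exists_apply_eq_one (hI : IsStrictlyProperIdeal I)
    (h𝒜 : IsSetAlgebra 𝒜) (hcyl : cylinders ⊆ 𝒜) (hC : C ∈ cylinders) :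
    ∃ P ∈ extensions 0 (I ∩ 𝒜) 𝒜, P C = 1 := by
  obtain ⟨U, hCU, hIU⟩ := hI.exists_ultrafilter hC
  refine ⟨𝒜.indicator ({E | E ∈ U}.indicator 1),
    ⟨(isCharge_indicator_ultrafilter 𝒜 U).isFinAddProb_indicator h𝒜 ?_, fun E hE => ?_⟩, ?_⟩
  · rw [indicator_of_mem (show univ ∈ {E | E ∈ U} from univ_mem), Pi.one_apply]
  · rw [indicator_of_mem hE.2, indicator_of_notMem (show E ∉ {E | E ∈ U} from hIU E hE.1),
      Pi.zero_apply]
  · rw [indicator_of_mem (hcyl hC), indicator_of_mem (mem_ofPred_eq ▸ hCU), Pi.one_apply]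

theorem IsStrictlyProperIdeal.exists_apply_cyl_eq_half_pow (hI : IsStrictlyProperIdeal I)
    (h𝒜 : IsSetAlgebra 𝒜) (hcyl : cylinders ⊆ 𝒜) (t : ℕ) :
    ∃ P ∈ extensions 0 (I ∩ 𝒜) 𝒜, ∀ ω, P (cyl ω t) = (1 / 2) ^ t := by
  choose δ hδ hδ_one using fun w : Fin t → Bool =>
    hI.exists_apply_eq_one h𝒜 hcyl (history_fiber_mem_cylinders t w)
  have hδ_zero (w v : Fin t → Bool) (hvw : v ≠ w) : δ w (history t ⁻¹' {v}) = 0 :=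
    (hδ w).1.eq_zero_of_disjoint h𝒜 (hcyl (history_fiber_mem_cylinders t w)) (hδ_one w)
      (hcyl (history_fiber_mem_cylinders t v)) <|
      disjoint_singleton.2 hvw.symm |>.preimage (history t)
  refine ⟨∑ w, (1 / 2 : ℝ) ^ t • δ w, (convex_extensions _ _ _).sum_mem (fun _ _ => by positivity)
    ?_ fun w _ => hδ w, fun ω => ?_⟩
  · simp [Finset.card_univ]
  · rw [← history_preimage_history, Finset.sum_apply, Finset.sum_eq_single (history t ω)]
    · simp [hδ_one]
    · intro w _ hw
      simp [hδ_zero w _ hw.symm]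
    · simp

theorem apply_cyl_eq_half_pow_of_succ (hP : AdditiveOn 𝒜 P) (hcyl : cylinders ⊆ 𝒜) {t : ℕ}
    (hunif : ∀ ω, P (cyl ω (t + 1)) = (1 / 2) ^ (t + 1)) (ω : BinPath) :
    P (cyl ω t) = (1 / 2) ^ t := by
  have hsplit : cyl ω t =
      cyl (Function.update ω t true) (t + 1) ∪ cyl (Function.update ω t false) (t + 1) := by
    rw [cyl, ← PiNat.iUnion_cylinder_update, union_eq_iUnion]
    exact iUnion_congr fun b => by cases b <;> rfl
  have hdisj : Disjoint (cyl (Function.update ω t true) (t + 1))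
      (cyl (Function.update ω t false) (t + 1)) := by
    refine disjoint_left.2 fun η h₁ h₀ => ?_
    simpa [h₁ t t.lt_succ_self] using h₀ t t.lt_succ_self
  rw [hsplit, hP _ (hcyl ⟨_, _, rfl⟩) _ (hcyl ⟨_, _, rfl⟩) hdisj, hunif, hunif]
  ring

theorem IsStrictlyProperIdeal.exists_forall_apply_cyl (hI : IsStrictlyProperIdeal I)
    (h𝒜 : IsSetAlgebra 𝒜) (hcyl : cylinders ⊆ 𝒜) :
    ∃ P ∈ extensions 0 (I ∩ 𝒜) 𝒜, ∀ ω t, P (cyl ω t) = (1 / 2) ^ t := by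
  set K : ℕ → Set (Set BinPath → ℝ) := fun t =>
    extensions 0 (I ∩ 𝒜) 𝒜 ∩ {P | ∀ ω, P (cyl ω t) = (1 / 2) ^ t}
  have hclosed (t : ℕ) : IsClosed (K t) := by
    refine (isClosed_extensions _ _ _).inter ?_
    simp only [ofPred_forall]
    exact isClosed_iInter fun ω => isClosed_eq (by fun_prop) (by fun_prop)
  obtain ⟨P, hP⟩ := IsCompact.nonempty_iInter_of_sequence_nonempty_isCompact_isClosed K
    (fun t P hP => ⟨hP.1, apply_cyl_eq_half_pow_of_succ hP.1.1.union_eq hcyl hP.2⟩)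
    (fun t => hI.exists_apply_cyl_eq_half_pow h𝒜 hcyl t)
    ((isCompact_extensions _ _ h𝒜).of_isClosed_subset (hclosed 0) inter_subset_left) hclosed
  rw [mem_iInter] at hP
  exact ⟨P, (hP 0).1, fun ω t => (hP t).2 ω⟩

end Existence

section SmallLarge

variable {Sig : MeasurableSpace BinPath} {I 𝒜 ℬ 𝒢 : Set (Set BinPath)} {P p : Set BinPath → ℝ}

theorem smallLargeAlgebra_subset_events (hcyl : cylinders ⊆ events Sig) :
    smallLargeAlgebra Sig I ⊆ events Sig :=
  (isSetAlgebra_events Sig).generateSetAlgebra_subset (union_subset hcyl fun _ hE => hE.1)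

theorem cylinders_union_subset_smallLargeAlgebra :
    cylinders ∪ I ∩ events Sig ⊆ smallLargeAlgebra Sig I := by
  have hsmall : I ∩ events Sig ⊆ {E ∈ events Sig | E ∈ I ∨ Eᶜ ∈ I} :=
    fun _ hE => ⟨hE.2, .inl hE.1⟩
  exact (union_subset_union_right _ hsmall).trans self_subset_generateSetAlgebra

theorem IsFinAddProb.indicator_of_subset (hP : IsFinAddProb 𝒜 P) (hℬ : IsSetAlgebra ℬ)
    (hsub : ℬ ⊆ 𝒜) : IsFinAddProb ℬ (ℬ.indicator P) :=
  IsCharge.isFinAddProb_indicator ⟨fun E hE => hP.nonneg E (hsub hE),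
    fun E hE F hF => hP.union_eq E (hsub hE) F (hsub hF)⟩ hℬ hP.univ_eq_one

theorem mem_extremePoints_extensions_indicator (hP : P ∈ (extensions p 𝒢 𝒜).extremePoints ℝ)
    (h𝒢 : 𝒢 ⊆ ℬ) : P ∈ (extensions (ℬ.indicator P) ℬ 𝒜).extremePoints ℝ := by
  have hsub : extensions (ℬ.indicator P) ℬ 𝒜 ⊆ extensions p 𝒢 𝒜 := fun Q hQ => by
    refine ⟨hQ.1, fun G hG => ?_⟩
    rw [hQ.2 G (h𝒢 hG), indicator_of_mem (h𝒢 hG), hP.1.2 G hG]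
  exact inter_extremePoints_subset_extremePoints_of_subset hsub
    ⟨⟨hP.1.1, fun A hA => (indicator_of_mem hA P).symm⟩, hP⟩

theorem IsStrictlyProperIdeal.exists_mem_extremePoints (hI : IsStrictlyProperIdeal I)
    (h𝒜 : IsSetAlgebra 𝒜) (hcyl : cylinders ⊆ 𝒜) :
    ∃ p P : Set BinPath → ℝ, P ∈ (extensions p (cylinders ∪ I ∩ 𝒜) 𝒜).extremePoints ℝ ∧
      (∀ ω t, P (cyl ω t) = (1 / 2) ^ t) ∧ ∀ E ∈ I ∩ 𝒜, P E = 0 := by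
  obtain ⟨p, hp, hunif⟩ := hI.exists_forall_apply_cyl h𝒜 hcyl
  obtain ⟨P, hP⟩ := (isCompact_extensions p (cylinders ∪ I ∩ 𝒜) h𝒜).extremePoints_nonempty
    ⟨p, hp.1, fun _ _ => rfl⟩
  refine ⟨p, P, hP, fun ω t => ?_, fun E hE => ?_⟩
  · rw [hP.1.2 _ (.inl ⟨ω, t, rfl⟩), hunif]
  · rw [hP.1.2 E (.inr hE), hp.2 E hE, Pi.zero_apply]

end SmallLarge

/-- For every strictly proper ideal `I` there is an opinion in `Δ_BD` that vanishes on every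
event in `I`; moreover it is an extreme point of the set of extensions to all events of a finitely
additive probability on the algebra generated by the cylinders and the small and large events. -/
theorem theorem4 (Sig : MeasurableSpace BinPath) (hSig : cylinders ⊆ events Sig)
    (I : Set (Set BinPath)) (hI : IsStrictlyProperIdeal I) :
    ∃ P ∈ DeltaBD Sig, (∀ E ∈ events Sig, E ∈ I → P E = 0) ∧
      ∃ p : Set BinPath → ℝ, IsFinAddProb (smallLargeAlgebra Sig I) p ∧
        P ∈ (extensions p (smallLargeAlgebra Sig I) (events Sig)).extremePoints ℝ := by
  have hevents := isSetAlgebra_events Sig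
  obtain ⟨p, P, hP, hunif, hnull⟩ := hI.exists_mem_extremePoints hevents hSig
  have hprob : IsFinAddProb (events Sig) P := hP.1.1
  have hdense : FiberDense (events Sig) P history :=
    fiberDense_of_mem_extremePoints_extensions hP hevents
      (union_subset hSig inter_subset_right) hSig fun G => Or.imp_right (hnull G)
  have hopinion : IsOpinion Sig P :=
    ⟨hprob, stronglyNonatomic_of_apply_cyl hSig hprob.isCharge hunif⟩
  have hBD : BlackwellDubins Sig P := fun Q hQ =>
    merges_of_fiberDense hSig hprob.isCharge hQ.isCharge hdense
  exact ⟨P, ⟨hopinion, hBD⟩, fun E hE hEI => hnull E ⟨hEI, hE⟩,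
    (smallLargeAlgebra Sig I).indicator P,
    hprob.indicator_of_subset isSetAlgebra_generateSetAlgebra
      (smallLargeAlgebra_subset_events hSig),
    mem_extremePoints_extensions_indicator hP cylinders_union_subset_smallLargeAlgebra⟩
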